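/- Let $r,z:[0,\infty)\to\mathbb R$ be $C^2$ on $(0,\infty)$ with $r>0$ and $(r')^2+(z')^2=1$ on $(0,\infty)$, $r(0)=0$, $r'(0)=1$, such that $$p:\mathbb R^3\to\mathbb R^4,\qquad p(s\xi)=(r(s)\,\xi,\;z(s))\qquad(s\ge 0,\ \xi\in\mathbb S^2\subset\mathbb R^3)$$ is of class $C^2$ and a topological embedding. Then $\Sigma=p(\mathbb R^3)$, with the induced metric, is called a ($C^2$, embedded, complete) $3$-dimensional spherically symmetric hypersurface of $\mathbb R^4$ with pole $p(0)$. Put $$k_s=r'z''-r''z',\qquad k_\theta=\frac{z'}{r}\qquad\text{on }(0,\infty),$$ let $A$ be the Weingarten map of $\Sigma$ and $c_2(A)$ the second elementary symmetric polynomial of its eigenvalues. For $a>0$ let $$\mathcal K_2=\eta_2\,c_2(A),\qquad \eta_2=\int_{-a}^{a}u^2\left(\chi_1'(u)^2-\left(\tfrac{\pi}{2a}\right)^2\chi_1(u)^2\right)du,\qquad \chi_1(u)=\cos\frac{\pi u}{2a}.$$ Suppose that $\Sigma$ is not a hyperplane and that $\mathcal K_2$ is integrable on $\Sigma$ with respect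 to the Riemannian volume measure $d\Sigma$ of the induced metric. Then: (1) $\Sigma$ is non-parabolic, that is, there is a non-constant positive superharmonic function on $\Sigma$: a function $u\in C^2(\Sigma)$, $u>0$, not constant, with $\Delta_\Sigma u\le 0$ everywhere, where $\Delta_\Sigma$ is the Laplace–Beltrami operator of $\Sigma$; (2) $\displaystyle\lim_{s\to\infty}\frac{r(s)}{s}=1$; (3) $k_sk_\theta r$ is integrable on $(0,\infty)$ and $\displaystyle\int_0^\infty k_s(s)k_\theta(s)r(s)\,ds=0$; moreover there is a non-empty connected open subset $U\subset\Sigma$ (a domain), not containing the pole, such that $k_s$ and $k_\theta$ are non-zero and have the same sign at every point of $U$. -/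

import Mathlib

open Real Set Filter Topology MeasureTheory

noncomputable section

namespace RotHyp

/-- Euclidean `3`-space (the parameter space) and Euclidean `4`-space (the ambient space). -/
abbrev E3 : Type := EuclideanSpace ℝ (Fin 3)

abbrev E4 : Type := EuclideanSpace ℝ (Fin 4)

/-! ### Differential geometry of a parametrized hypersurface `p : ℝ³ → ℝ⁴` -/

/-- The partial derivative `∂ᵢ f` of a map on `ℝ³`. -/
def partialD {F : Type} [NormedAddCommGroup F] [NormedSpace ℝ F]
    (f : E3 → F) (i : Fin 3) (x : E3) : F :=
  fderiv ℝ f x (EuclideanSpace.single i (1 : ℝ))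

/-- The induced metric (first fundamental form) `g i j = ⟨∂ᵢ p, ∂ⱼ p⟩`. -/
def metric (p : E3 → E4) (x : E3) : Matrix (Fin 3) (Fin 3) ℝ :=
  Matrix.of fun i j => inner ℝ (partialD p i x) (partialD p j x)

/-- The density `√(det g)` of the induced volume element. -/
def volDensity (p : E3 → E4) (x : E3) : ℝ := √(metric p x).det

/-- The volume measure `dΣ = √(det g) dx` of the hypersurface, in the global chart. -/
def volMeasure (p : E3 → E4) : Measure E3 :=
  (volume : Measure E3).withDensity fun x => ENNReal.ofReal (volDensity p x)

/-- The unit normal: the normalized vector product of `∂₀ p, ∂₁ p, ∂₂ p` in `ℝ⁴`, i.e.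
`⟨n, w⟩ = det (∂₀ p, ∂₁ p, ∂₂ p, w) / √(det g)` for all `w`. -/
def unitNormal (p : E3 → E4) (x : E3) : E4 :=
  WithLp.toLp 2 fun i : Fin 4 =>
    (Matrix.of ![fun k => partialD p 0 x k, fun k => partialD p 1 x k,
      fun k => partialD p 2 x k, fun k => if k = i then (1 : ℝ) else 0]).det / volDensity p x

/-- The second fundamental form `h i j = ⟨∂ⱼ ∂ᵢ p, n⟩`. -/
def secondForm (p : E3 → E4) (x : E3) : Matrix (Fin 3) (Fin 3) ℝ :=
  Matrix.of fun i j => inner ℝ (partialD (partialD p i) j x) (unitNormal p x)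

/-- The Weingarten map `A = g⁻¹ h`; its eigenvalues are the principal curvatures. -/
def weingarten (p : E3 → E4) (x : E3) : Matrix (Fin 3) (Fin 3) ℝ :=
  (metric p x)⁻¹ * secondForm p x

/-- `c₂(A)`: the second elementary symmetric polynomial of the eigenvalues of the Weingarten map,
read off from `det (X - A) = X³ - c₁ X² + c₂ X - c₃`. -/
def c2 (p : E3 → E4) (x : E3) : ℝ := (weingarten p x).charpoly.coeff 1

/-- The Laplace-Beltrami operator of the induced metric,
`Δ f = (det g)^(-1/2) ∑ᵢ ∂ᵢ ((det g)^(1/2) ∑ⱼ g^{ij} ∂ⱼ f)`. -/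
def laplaceBeltrami (p : E3 → E4) (f : E3 → ℝ) (x : E3) : ℝ :=
  (volDensity p x)⁻¹ *
    ∑ i, partialD (fun y => volDensity p y * ∑ j, (metric p y)⁻¹ i j * partialD f j y) i x

/-- `u` is a superharmonic function on the hypersurface `Σ = range p`: it is `C²` and `Δ u ≤ 0`. -/
def IsSuperharmonic (p : E3 → E4) (u : range p → ℝ) : Prop :=
  ContDiff ℝ 2 (u ∘ rangeFactorization p) ∧
    ∀ x, laplaceBeltrami p (u ∘ rangeFactorization p) x ≤ 0

/-- The (complete) hypersurface `Σ = range p` is non-parabolic: it admits a non-constant positive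
superharmonic function. -/
def IsNonParabolic (p : E3 → E4) : Prop :=
  ∃ u : range p → ℝ, IsSuperharmonic p u ∧ (∀ q, 0 < u q) ∧ ∃ q₁ q₂, u q₁ ≠ u q₂

/-! ### The weighted curvature `𝒦₂` -/

/-- `χ₁(u) = cos (k₁ u)` with `k₁ = π / (2a)`. -/
def chi1 (a u : ℝ) : ℝ := Real.cos (π / (2 * a) * u)

/-- `η_k = ∫_{-a}^{a} u^k (χ₁'(u)² - k₁² χ₁(u)²) du`. -/
def eta (a : ℝ) (k : ℕ) : ℝ :=
  ∫ u in (-a)..a, u ^ k * (deriv (chi1 a) u ^ 2 - (π / (2 * a)) ^ 2 * chi1 a u ^ 2)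

/-- `𝒦₂ = η₂ c₂(A)`. For a hypersurface of `ℝ⁴` this is the only term of
`∑_{1 ≤ k ≤ 3/2} η_{2k} c_{2k}(A)`. -/
def calK2 (a : ℝ) (p : E3 → E4) (x : E3) : ℝ := eta a 2 * c2 p x

/-! ### Spherically symmetric hypersurfaces with a pole -/

/-- The rotational parametrization in geodesic polar coordinates `x = s ξ`, `s = ‖x‖`, `‖ξ‖ = 1`:
`p (s ξ) = (r(s) ξ, z(s))`; the origin is sent to the pole `(0, z(0))`. -/
def rotParam (r z : ℝ → ℝ) (x : E3) : E4 :=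
  !₂[r ‖x‖ * (x 0 / ‖x‖), r ‖x‖ * (x 1 / ‖x‖), r ‖x‖ * (x 2 / ‖x‖), z ‖x‖]

/-- The profile `(r, z)` (only its values on `[0, ∞)` matter) describes a `C²` spherically symmetric
hypersurface with a pole embedded in `ℝ⁴`, the range of `rotParam r z`. -/
structure IsSphSymWithPole (r z : ℝ → ℝ) : Prop where
  contDiffOn_r : ContDiffOn ℝ 2 r (Ioi 0)
  contDiffOn_z : ContDiffOn ℝ 2 z (Ioi 0)
  r_pos : ∀ s, 0 < s → 0 < r s
  /-- the profile curve is parametrized by arc length, so `s` is the distance to the pole -/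
  arcLength : ∀ s, 0 < s → deriv r s ^ 2 + deriv z s ^ 2 = 1
  r_zero : r 0 = 0
  deriv_r_zero : HasDerivWithinAt r 1 (Ici 0) 0
  /-- the hypersurface is `C²`, at the pole too -/
  contDiff_param : ContDiff ℝ 2 (rotParam r z)
  /-- the hypersurface is embedded -/
  isEmbedding_param : IsEmbedding (rotParam r z)

/-- The meridian principal curvature `k_s = r' z'' - r'' z'`. -/
def kS (r z : ℝ → ℝ) (s : ℝ) : ℝ :=
  deriv r s * deriv (deriv z) s - deriv (deriv r) s * deriv z s

/-- The rotational principal curvature `k_θ = z' / r`. -/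
def kTheta (r z : ℝ → ℝ) (s : ℝ) : ℝ := deriv z s / r s

/-- A set in `ℝ⁴` is a hyperplane. -/
def IsHyperplane (S : Set E4) : Prop :=
  ∃ H : AffineSubspace ℝ E4, Module.finrank ℝ H.direction = 3 ∧ S = (H : Set E4)

end RotHyp

end

/-!
In geodesic polar coordinates the induced metric is `ds² + r(s)² dθ²`, its principal curvatures are
`k_s, k_θ, k_θ`, and differentiating `r'² + z'² = 1` gives `k_s k_θ r = -r''`. Since `η₂ = a ≠ 0`, the
hypothesis says that `G = r² c₂(A) = 1 - r'² - 2 r r''` is integrable on `(0, ∞)`. Everything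
follows from this property of the radius function alone.

* Integrating `(2 r r')' = 1 + r'² - G` gives `2 r r' ≥ s - C`. Hence `r² ≥ s² / 2 - C s`, and `r'` is
  eventually positive (`IsIntegrableRadius.exists_linear_growth`).
* Integrating `(r (1 - r'²))' = r' G` gives `r (1 - r'²) ≤ C`. Together with the growth of `r` this
  yields `r' → 1`, hence `r / s → 1`, and the integrability of `r''`; then
  `∫ r'' = lim r' - r'(0) = 0`.
* As `r' ≤ 1 = r'(0)`, either `r' = 1` everywhere, and the hypersurface is a hyperplane, or `r'' < 0`
  somewhere, and there `k_s k_θ > 0`.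
* A radial function `v(s)` has Laplacian `(r² v')' / r²`. With a nondecreasing cutoff `H` that
  vanishes near the pole, `v' = -H / r²` gives a superharmonic function, and `v` can be kept positive
  because `r⁻²` is integrable at infinity.

At the pole the regularity of `r` is that of its odd extension to the line, which is a coordinate of
the `C²` parametrization restricted to an axis (`axisProfile`).
-/

noncomputable section

namespace RotHyp

/-! ### Partial derivatives of functions of the polar coordinates -/

/-- `f` is differentiable at `x` with `i`-th partial derivative `v`. -/
def HasPartialD (f : E3 → ℝ) (i : Fin 3) (v : ℝ) (x : E3) : Prop :=
  DifferentiableAt ℝ f x ∧ partialD f i x = v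

/-- The `i`-th coordinate of the direction `x / ‖x‖`. -/
def dir (i : Fin 3) (x : E3) : ℝ := x i / ‖x‖

lemma partialD_congr {F : Type} [NormedAddCommGroup F] [NormedSpace ℝ F] {f g : E3 → F} {x : E3}
    (h : f =ᶠ[𝓝 x] g) (i : Fin 3) : partialD f i x = partialD g i x := by
  simp only [partialD, h.fderiv_eq]

lemma HasPartialD.mul {f g : E3 → ℝ} {i : Fin 3} {v w : ℝ} {x : E3}
    (hf : HasPartialD f i v x) (hg : HasPartialD g i w x) :
    HasPartialD (fun y => f y * g y) i (v * g x + f x * w) x := by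
  refine ⟨hf.1.mul hg.1, ?_⟩
  have h1 := hf.2
  have h2 := hg.2
  simp only [partialD] at h1 h2 ⊢
  rw [fderiv_fun_mul hf.1 hg.1]
  simp [h1, h2]
  ring

lemma HasPartialD.add {f g : E3 → ℝ} {i : Fin 3} {v w : ℝ} {x : E3}
    (hf : HasPartialD f i v x) (hg : HasPartialD g i w x) :
    HasPartialD (fun y => f y + g y) i (v + w) x := by
  refine ⟨hf.1.add hg.1, ?_⟩
  have h1 := hf.2
  have h2 := hg.2
  simp only [partialD] at h1 h2 ⊢
  rw [fderiv_fun_add hf.1 hg.1]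
  simp [h1, h2]

lemma HasPartialD.sub {f g : E3 → ℝ} {i : Fin 3} {v w : ℝ} {x : E3}
    (hf : HasPartialD f i v x) (hg : HasPartialD g i w x) :
    HasPartialD (fun y => f y - g y) i (v - w) x := by
  refine ⟨hf.1.sub hg.1, ?_⟩
  have h1 := hf.2
  have h2 := hg.2
  simp only [partialD] at h1 h2 ⊢
  rw [fderiv_fun_sub hf.1 hg.1]
  simp [h1, h2]

lemma hasPartialD_const (c : ℝ) (i : Fin 3) (x : E3) : HasPartialD (fun _ => c) i 0 x := by
  refine ⟨differentiableAt_const c, ?_⟩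
  simp [partialD]

lemma hasPartialD_coord (k i : Fin 3) (x : E3) :
    HasPartialD (fun y => y k) i ((1 : Matrix (Fin 3) (Fin 3) ℝ) i k) x := by
  have h : HasFDerivAt (fun y : E3 => y k) (EuclideanSpace.proj k : E3 →L[ℝ] ℝ) x :=
    (EuclideanSpace.proj k : E3 →L[ℝ] ℝ).hasFDerivAt
  refine ⟨h.differentiableAt, ?_⟩
  simp [partialD, h.fderiv, Matrix.one_apply, eq_comm]

lemma hasPartialD_radial {f : ℝ → ℝ} {f' : ℝ} {x : E3} (hx : x ≠ 0) (hf : HasDerivAt f f' ‖x‖)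
    (i : Fin 3) : HasPartialD (fun y => f ‖y‖) i (f' * dir i x) x := by
  have hn : HasFDerivAt (fun y : E3 => ‖y‖) (‖x‖⁻¹ • innerSL ℝ x) x := by
    have h0 : 0 < ‖x‖ := norm_pos_iff.2 hx
    have h1 := ((hasStrictFDerivAt_norm_sq x).hasFDerivAt).sqrt (by positivity)
    have h2 : (fun y : E3 => √(‖y‖ ^ 2)) = fun y => ‖y‖ := by
      ext y; exact Real.sqrt_sq (norm_nonneg y)
    rw [h2] at h1
    have e : (1 / (2 * √(‖x‖ ^ 2))) • 2 • innerSL ℝ x = ‖x‖⁻¹ • innerSL ℝ x := by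
      rw [Real.sqrt_sq h0.le, ← Nat.cast_smul_eq_nsmul ℝ, smul_smul]
      congr 1
      push_cast
      field_simp
    rw [e] at h1
    exact h1
  have h := hf.comp_hasFDerivAt x hn
  refine ⟨h.differentiableAt, ?_⟩
  have h' : fderiv ℝ (fun y : E3 => f ‖y‖) x = f' • (‖x‖⁻¹ • innerSL ℝ x) := h.fderiv
  simp only [partialD, h', dir]
  simp [EuclideanSpace.inner_single_right, div_eq_inv_mul]

lemma hasPartialD_dir {x : E3} (hx : x ≠ 0) (k i : Fin 3) :
    HasPartialD (dir k) i
      (((1 : Matrix (Fin 3) (Fin 3) ℝ) i k - dir i x * dir k x) / ‖x‖) x := by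
  have h0 : ‖x‖ ≠ 0 := norm_ne_zero_iff.2 hx
  have h := (hasPartialD_coord k i x).mul (hasPartialD_radial hx (hasDerivAt_inv h0) i)
  have e : (fun y : E3 => y k * ‖y‖⁻¹) = dir k := by
    ext y; simp [dir, div_eq_mul_inv]
  rw [e] at h
  convert h using 1
  simp only [dir]
  field_simp
  ring

lemma sum_dir_sq {x : E3} (hx : x ≠ 0) : dir 0 x ^ 2 + dir 1 x ^ 2 + dir 2 x ^ 2 = 1 := by
  have h0 : ‖x‖ ≠ 0 := norm_ne_zero_iff.2 hx
  have h : ‖x‖ ^ 2 = x 0 ^ 2 + x 1 ^ 2 + x 2 ^ 2 := by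
    rw [EuclideanSpace.real_norm_sq_eq, Fin.sum_univ_three]
  simp only [dir, div_pow]
  rw [← add_div, ← add_div, ← h, div_self (pow_ne_zero 2 h0)]

/-- Partial derivatives of maps into a Euclidean space are computed coordinatewise. -/
lemma partialD_apply {f : E3 → E4} {x : E3} {i : Fin 3} {v : E4}
    (h : ∀ k, HasPartialD (fun y => f y k) i (v k) x) : partialD f i x = v := by
  have hd : DifferentiableAt ℝ f x := (differentiableAt_euclidean).2 fun k => (h k).1
  ext k
  rw [← (h k).2]
  have h1 : HasFDerivAt (fun y => f y k)
      ((EuclideanSpace.proj k : E4 →L[ℝ] ℝ).comp (fderiv ℝ f x)) x :=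
    (EuclideanSpace.proj k : E4 →L[ℝ] ℝ).hasFDerivAt.comp x hd.hasFDerivAt
  simp [partialD, h1.fderiv]

/-! ### Matrices `α n nᵀ + β (1 - n nᵀ)` for a unit vector `n` -/

/-- The symmetric matrix with eigenvalue `α` in the direction `x / ‖x‖` and eigenvalue `β` on
its orthogonal complement. -/
def axial (α β : ℝ) (x : E3) : Matrix (Fin 3) (Fin 3) ℝ :=
  Matrix.of fun i j => (α - β) * (dir i x * dir j x) + β * (1 : Matrix (Fin 3) (Fin 3) ℝ) i j

lemma axial_mul {x : E3} (hx : x ≠ 0) (α β γ δ : ℝ) :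
    axial α β x * axial γ δ x = axial (α * γ) (β * δ) x := by
  have h := sum_dir_sq hx
  ext i j
  simp only [Matrix.mul_apply, Fin.sum_univ_three, axial, Matrix.of_apply]
  have e : ∀ a b : Fin 3, (1 : Matrix (Fin 3) (Fin 3) ℝ) a b = if a = b then 1 else 0 :=
    fun a b => Matrix.one_apply
  fin_cases i <;> fin_cases j <;> simp [e] <;> grind

lemma axial_one (x : E3) : axial 1 1 x = 1 := by
  ext i j; simp [axial]

lemma axial_inv {x : E3} (hx : x ≠ 0) {α β : ℝ} (hα : α ≠ 0) (hβ : β ≠ 0) :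
    (axial α β x)⁻¹ = axial α⁻¹ β⁻¹ x := by
  refine Matrix.inv_eq_right_inv ?_
  rw [axial_mul hx, mul_inv_cancel₀ hα, mul_inv_cancel₀ hβ, axial_one]

lemma axial_det {x : E3} (hx : x ≠ 0) (α β : ℝ) : (axial α β x).det = α * β ^ 2 := by
  have h := sum_dir_sq hx
  rw [Matrix.det_fin_three]
  simp [axial, Matrix.one_apply]
  linear_combination (α - β) * β ^ 2 * h

lemma axial_charpoly {x : E3} (hx : x ≠ 0) (α β : ℝ) :
    (axial α β x).charpoly =
      (Polynomial.X - Polynomial.C α) * (Polynomial.X - Polynomial.C β) ^ 2 := by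
  have h := congrArg (Polynomial.C (R := ℝ)) (sum_dir_sq hx)
  simp only [map_add, map_pow, map_one] at h
  rw [Matrix.charpoly, Matrix.det_fin_three]
  simp [axial, Matrix.one_apply]
  linear_combination (Polynomial.C β - Polynomial.C α) * (Polynomial.X - Polynomial.C β) ^ 2 * h

lemma axial_charpoly_coeff_one {x : E3} (hx : x ≠ 0) (α β : ℝ) :
    (axial α β x).charpoly.coeff 1 = 2 * α * β + β ^ 2 := by
  have e : (Polynomial.X - Polynomial.C α) * (Polynomial.X - Polynomial.C β) ^ 2 =
      Polynomial.X ^ 3 - Polynomial.C (α + 2 * β) * Polynomial.X ^ 2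
        + Polynomial.C (2 * α * β + β ^ 2) * Polynomial.X - Polynomial.C (α * β ^ 2) := by
    simp only [map_add, map_mul, map_pow, map_ofNat]
    ring
  rw [axial_charpoly hx, e]
  simp [Polynomial.coeff_C, Polynomial.coeff_X_pow, -map_add, -map_mul]

/-! ### The fundamental forms of the rotational parametrization -/

lemma rotParam_castSucc (r z : ℝ → ℝ) (x : E3) (k : Fin 3) :
    rotParam r z x k.castSucc = r ‖x‖ * dir k x := by
  fin_cases k <;> rfl

/-- The vector `(v, c)` of `ℝ⁴ = ℝ³ × ℝ`. -/
def appendLast (v : Fin 3 → ℝ) (c : ℝ) : E4 := !₂[v 0, v 1, v 2, c]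

lemma appendLast_castSucc (v : Fin 3 → ℝ) (c : ℝ) (k : Fin 3) :
    appendLast v c k.castSucc = v k := by
  fin_cases k <;> rfl

lemma appendLast_last (v : Fin 3 → ℝ) (c : ℝ) : appendLast v c (Fin.last 3) = c := rfl

/-- The partial derivative `∂ᵢ p` of the rotational parametrization. -/
def tangent (r z : ℝ → ℝ) (i : Fin 3) (x : E3) : E4 :=
  appendLast
    (fun k : Fin 3 => deriv r ‖x‖ * (dir i x * dir k x)
      + r ‖x‖ / ‖x‖ * ((1 : Matrix (Fin 3) (Fin 3) ℝ) i k - dir i x * dir k x))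
    (deriv z ‖x‖ * dir i x)

lemma tangent_castSucc (r z : ℝ → ℝ) (i k : Fin 3) (x : E3) :
    tangent r z i x k.castSucc = deriv r ‖x‖ * (dir i x * dir k x)
      + r ‖x‖ / ‖x‖ * ((1 : Matrix (Fin 3) (Fin 3) ℝ) i k - dir i x * dir k x) :=
  appendLast_castSucc _ _ k

lemma tangent_last (r z : ℝ → ℝ) (i : Fin 3) (x : E3) :
    tangent r z i x (Fin.last 3) = deriv z ‖x‖ * dir i x :=
  appendLast_last _ _

variable {r z : ℝ → ℝ}

lemma partialD_rotParam {x : E3} (hx : x ≠ 0) (hr : DifferentiableAt ℝ r ‖x‖)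
    (hz : DifferentiableAt ℝ z ‖x‖) (i : Fin 3) :
    partialD (rotParam r z) i x = tangent r z i x := by
  refine partialD_apply fun k => ?_
  induction k using Fin.lastCases with
  | last =>
    rw [tangent_last]
    exact hasPartialD_radial hx hz.hasDerivAt i
  | cast k =>
    rw [tangent_castSucc]
    simp only [rotParam_castSucc]
    convert (hasPartialD_radial hx hr.hasDerivAt i).mul (hasPartialD_dir hx k i) using 1
    ring

/-- The induced metric is `ds² + r² dθ²`, which in the chart `x = s n` has the radial eigenvalue `1`
and the tangential eigenvalue `(r / s)²`. -/
lemma metric_rotParam {x : E3} (hx : x ≠ 0) (hr : DifferentiableAt ℝ r ‖x‖)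
    (hz : DifferentiableAt ℝ z ‖x‖) (harc : deriv r ‖x‖ ^ 2 + deriv z ‖x‖ ^ 2 = 1) :
    metric (rotParam r z) x = axial 1 ((r ‖x‖ / ‖x‖) ^ 2) x := by
  have h := sum_dir_sq hx
  ext i j
  simp only [metric, axial, Matrix.of_apply, partialD_rotParam hx hr hz, PiLp.inner_apply,
    Fin.sum_univ_castSucc (n := 3), tangent_castSucc, tangent_last, Fin.sum_univ_three]
  generalize r ‖x‖ / ‖x‖ = φ
  generalize deriv r ‖x‖ = a at *
  generalize deriv z ‖x‖ = b at *
  have e : ∀ a b : Fin 3, (1 : Matrix (Fin 3) (Fin 3) ℝ) a b = if a = b then 1 else 0 :=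
    fun a b => Matrix.one_apply
  fin_cases i <;> fin_cases j <;> simp [e] <;> grind

lemma volDensity_rotParam {x : E3} (hx : x ≠ 0) (hr : DifferentiableAt ℝ r ‖x‖)
    (hz : DifferentiableAt ℝ z ‖x‖) (harc : deriv r ‖x‖ ^ 2 + deriv z ‖x‖ ^ 2 = 1) :
    volDensity (rotParam r z) x = (r ‖x‖ / ‖x‖) ^ 2 := by
  rw [volDensity, metric_rotParam hx hr hz harc, axial_det hx, one_mul,
    Real.sqrt_sq (by positivity)]

/-- The unit normal is `(-z' n, r')` with `n = x / ‖x‖`. -/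
lemma unitNormal_rotParam {x : E3} (hx : x ≠ 0) (hr : DifferentiableAt ℝ r ‖x‖)
    (hz : DifferentiableAt ℝ z ‖x‖) (harc : deriv r ‖x‖ ^ 2 + deriv z ‖x‖ ^ 2 = 1)
    (hpos : 0 < r ‖x‖) :
    (∀ k : Fin 3, unitNormal (rotParam r z) x k.castSucc = - deriv z ‖x‖ * dir k x) ∧
      unitNormal (rotParam r z) x (Fin.last 3) = deriv r ‖x‖ := by
  have h := sum_dir_sq hx
  have hs : 0 < ‖x‖ := norm_pos_iff.2 hx
  have hφ : 0 < r ‖x‖ / ‖x‖ := by positivity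
  have t0 : ∀ i, tangent r z i x 0 = _ := fun i => tangent_castSucc r z i 0 x
  have t1 : ∀ i, tangent r z i x 1 = _ := fun i => tangent_castSucc r z i 1 x
  have t2 : ∀ i, tangent r z i x 2 = _ := fun i => tangent_castSucc r z i 2 x
  have t3 : ∀ i, tangent r z i x 3 = _ := fun i => tangent_last r z i x
  have e : ∀ a b : Fin 3, (1 : Matrix (Fin 3) (Fin 3) ℝ) a b = if a = b then 1 else 0 :=
    fun a b => Matrix.one_apply
  -- the four-dimensional vector product of the three tangent vectors, paired with `w`
  have hdet : ∀ w : Fin 4 → ℝ, (Matrix.of ![fun k => partialD (rotParam r z) 0 x k,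
      fun k => partialD (rotParam r z) 1 x k, fun k => partialD (rotParam r z) 2 x k, w]).det
      = (r ‖x‖ / ‖x‖) ^ 2 * (deriv r ‖x‖ * w 3
        - deriv z ‖x‖ * (dir 0 x * w 0 + dir 1 x * w 1 + dir 2 x * w 2)) := by
    intro w
    simp only [partialD_rotParam hx hr hz]
    simp [Matrix.det_succ_row_zero, Fin.sum_univ_succ, Fin.succAbove, t0, t1, t2, t3, e]
    generalize r ‖x‖ / ‖x‖ = φ
    generalize deriv r ‖x‖ = a at *
    generalize deriv z ‖x‖ = b at *
    linear_combination φ ^ 2 * (a - φ) * w 3 * h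
  constructor
  · intro k
    simp only [unitNormal, hdet, volDensity_rotParam hx hr hz harc]
    fin_cases k <;> simp <;> field_simp
  · simp only [unitNormal, hdet, volDensity_rotParam hx hr hz harc]
    simp [Fin.last]
    field_simp

lemma partialD_partialD_rotParam {x : E3} (hx : x ≠ 0)
    (hr : ∀ᶠ s in 𝓝 ‖x‖, DifferentiableAt ℝ r s) (hz : ∀ᶠ s in 𝓝 ‖x‖, DifferentiableAt ℝ z s)
    (hr2 : DifferentiableAt ℝ (deriv r) ‖x‖) (hz2 : DifferentiableAt ℝ (deriv z) ‖x‖)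
    (i j : Fin 3) :
    (∀ k : Fin 3, partialD (partialD (rotParam r z) i) j x k.castSucc =
      deriv (deriv r) ‖x‖ * dir j x * (dir i x * dir k x)
      + (deriv r ‖x‖ - r ‖x‖ / ‖x‖) / ‖x‖ *
        (((1 : Matrix (Fin 3) (Fin 3) ℝ) j i - dir j x * dir i x) * dir k x
        + dir i x * ((1 : Matrix (Fin 3) (Fin 3) ℝ) j k - dir j x * dir k x)
        + dir j x * ((1 : Matrix (Fin 3) (Fin 3) ℝ) i k - dir i x * dir k x))) ∧
    partialD (partialD (rotParam r z) i) j x (Fin.last 3) =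
      deriv (deriv z) ‖x‖ * dir j x * dir i x
      + deriv z ‖x‖ / ‖x‖ * ((1 : Matrix (Fin 3) (Fin 3) ℝ) j i - dir j x * dir i x) := by
  have hs : ‖x‖ ≠ 0 := norm_ne_zero_iff.2 hx
  have hev : partialD (rotParam r z) i =ᶠ[𝓝 x] tangent r z i := by
    have hc : Tendsto (fun y : E3 => ‖y‖) (𝓝 x) (𝓝 ‖x‖) := continuous_norm.tendsto x
    filter_upwards [hc.eventually hr, hc.eventually hz, isOpen_ne.mem_nhds hx] with y h1 h2 h3
    exact partialD_rotParam h3 h1 h2 i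
  have hr1 := hr.self_of_nhds.hasDerivAt
  have hφ : HasDerivAt (fun s => r s / s) ((deriv r ‖x‖ - r ‖x‖ / ‖x‖) / ‖x‖) ‖x‖ := by
    refine (hr1.fun_div (hasDerivAt_id' ‖x‖) hs).congr_deriv ?_
    field_simp
  have h : partialD (partialD (rotParam r z) i) j x = (appendLast
      (fun k : Fin 3 => deriv (deriv r) ‖x‖ * dir j x * (dir i x * dir k x)
      + (deriv r ‖x‖ - r ‖x‖ / ‖x‖) / ‖x‖ *
        (((1 : Matrix (Fin 3) (Fin 3) ℝ) j i - dir j x * dir i x) * dir k x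
        + dir i x * ((1 : Matrix (Fin 3) (Fin 3) ℝ) j k - dir j x * dir k x)
        + dir j x * ((1 : Matrix (Fin 3) (Fin 3) ℝ) i k - dir i x * dir k x)))
      (deriv (deriv z) ‖x‖ * dir j x * dir i x
      + deriv z ‖x‖ / ‖x‖ * ((1 : Matrix (Fin 3) (Fin 3) ℝ) j i - dir j x * dir i x))) := by
    rw [partialD_congr hev]
    refine partialD_apply fun k => ?_
    induction k using Fin.lastCases with
    | last =>
      simp only [tangent_last, appendLast_last]
      convert (hasPartialD_radial hx hz2.hasDerivAt j).mul (hasPartialD_dir hx i j) using 1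
      ring
    | cast k =>
      simp only [tangent_castSucc, appendLast_castSucc]
      have hnn := (hasPartialD_dir hx i j).mul (hasPartialD_dir hx k j)
      convert ((hasPartialD_radial hx hr2.hasDerivAt j).mul hnn).add
        ((hasPartialD_radial hx hφ j).mul ((hasPartialD_const _ j x).sub hnn)) using 1
      ring
  constructor
  · intro k
    rw [h]
    exact appendLast_castSucc _ _ k
  · rw [h]
    exact appendLast_last _ _

lemma secondForm_rotParam {x : E3} (hx : x ≠ 0)
    (hr : ∀ᶠ s in 𝓝 ‖x‖, DifferentiableAt ℝ r s) (hz : ∀ᶠ s in 𝓝 ‖x‖, DifferentiableAt ℝ z s)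
    (hr2 : DifferentiableAt ℝ (deriv r) ‖x‖) (hz2 : DifferentiableAt ℝ (deriv z) ‖x‖)
    (harc : deriv r ‖x‖ ^ 2 + deriv z ‖x‖ ^ 2 = 1) (hpos : 0 < r ‖x‖) :
    secondForm (rotParam r z) x =
      axial (kS r z ‖x‖) ((r ‖x‖ / ‖x‖) ^ 2 * kTheta r z ‖x‖) x := by
  have h := sum_dir_sq hx
  have hs : ‖x‖ ≠ 0 := norm_ne_zero_iff.2 hx
  obtain ⟨n1, n2⟩ := unitNormal_rotParam hx hr.self_of_nhds hz.self_of_nhds harc hpos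
  have hkθ : (r ‖x‖ / ‖x‖) ^ 2 * kTheta r z ‖x‖ = r ‖x‖ / ‖x‖ * (deriv z ‖x‖ / ‖x‖) := by
    have := hpos.ne'
    rw [kTheta]
    field_simp
  rw [hkθ]
  ext i j
  obtain ⟨d1, d2⟩ := partialD_partialD_rotParam hx hr hz hr2 hz2 i j
  simp only [secondForm, axial, Matrix.of_apply, PiLp.inner_apply,
    Fin.sum_univ_castSucc (n := 3), Fin.sum_univ_three, d1, d2, n1, n2, kS]
  have hδ : ∀ i, (1 : Matrix (Fin 3) (Fin 3) ℝ) i 0 * dir 0 x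
      + (1 : Matrix (Fin 3) (Fin 3) ℝ) i 1 * dir 1 x
      + (1 : Matrix (Fin 3) (Fin 3) ℝ) i 2 * dir 2 x = dir i x := by
    intro i
    fin_cases i <;> simp [Matrix.one_apply]
  have hsymm : (1 : Matrix (Fin 3) (Fin 3) ℝ) j i = (1 : Matrix (Fin 3) (Fin 3) ℝ) i j := by
    simp [Matrix.one_apply, eq_comm]
  rw [hsymm]
  simp only [div_eq_mul_inv, RCLike.inner_apply, conj_trivial]
  linear_combination (-deriv z ‖x‖) * (deriv (deriv r) ‖x‖ * dir i x * dir j x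
      + ‖x‖⁻¹ * (deriv r ‖x‖ - r ‖x‖ * ‖x‖⁻¹)
        * ((1 : Matrix (Fin 3) (Fin 3) ℝ) i j - 3 * dir i x * dir j x)) * h
    - deriv z ‖x‖ * ‖x‖⁻¹ * (deriv r ‖x‖ - r ‖x‖ * ‖x‖⁻¹)
      * (dir i x * hδ j + dir j x * hδ i)

/-- The principal curvatures are `k_s` along the meridian and `k_θ`, twice, orthogonally to it. -/
lemma weingarten_rotParam {x : E3} (hx : x ≠ 0)
    (hr : ∀ᶠ s in 𝓝 ‖x‖, DifferentiableAt ℝ r s) (hz : ∀ᶠ s in 𝓝 ‖x‖, DifferentiableAt ℝ z s)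
    (hr2 : DifferentiableAt ℝ (deriv r) ‖x‖) (hz2 : DifferentiableAt ℝ (deriv z) ‖x‖)
    (harc : deriv r ‖x‖ ^ 2 + deriv z ‖x‖ ^ 2 = 1) (hpos : 0 < r ‖x‖) :
    weingarten (rotParam r z) x = axial (kS r z ‖x‖) (kTheta r z ‖x‖) x := by
  have hs : 0 < ‖x‖ := norm_pos_iff.2 hx
  have hφ : (r ‖x‖ / ‖x‖) ^ 2 ≠ 0 := by positivity
  rw [weingarten, metric_rotParam hx hr.self_of_nhds hz.self_of_nhds harc,
    secondForm_rotParam hx hr hz hr2 hz2 harc hpos, axial_inv hx one_ne_zero hφ, axial_mul hx,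
    inv_one, one_mul, inv_mul_cancel_left₀ hφ]

lemma c2_rotParam {x : E3} (hx : x ≠ 0)
    (hr : ∀ᶠ s in 𝓝 ‖x‖, DifferentiableAt ℝ r s) (hz : ∀ᶠ s in 𝓝 ‖x‖, DifferentiableAt ℝ z s)
    (hr2 : DifferentiableAt ℝ (deriv r) ‖x‖) (hz2 : DifferentiableAt ℝ (deriv z) ‖x‖)
    (harc : deriv r ‖x‖ ^ 2 + deriv z ‖x‖ ^ 2 = 1) (hpos : 0 < r ‖x‖) :
    c2 (rotParam r z) x = 2 * kS r z ‖x‖ * kTheta r z ‖x‖ + kTheta r z ‖x‖ ^ 2 := by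
  rw [c2, weingarten_rotParam hx hr hz hr2 hz2 harc hpos, axial_charpoly_coeff_one hx]

/-- For a radial function `u = v(‖x‖)` the Laplace-Beltrami operator is
`(r² v')' / r²`; it is stated in terms of `w = r² v'`, which is the flux of the gradient of `u`. -/
lemma laplaceBeltrami_radial {x : E3} (hx : x ≠ 0)
    (hr : ∀ᶠ s in 𝓝 ‖x‖, DifferentiableAt ℝ r s) (hz : ∀ᶠ s in 𝓝 ‖x‖, DifferentiableAt ℝ z s)
    (harc : ∀ᶠ s in 𝓝 ‖x‖, deriv r s ^ 2 + deriv z s ^ 2 = 1) (hpos : ∀ᶠ s in 𝓝 ‖x‖, 0 < r s)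
    {v w : ℝ → ℝ} (hv : ∀ᶠ s in 𝓝 ‖x‖, HasDerivAt v (w s / r s ^ 2) s) {w' : ℝ}
    (hw : HasDerivAt w w' ‖x‖) :
    laplaceBeltrami (rotParam r z) (fun y => v ‖y‖) x = w' / r ‖x‖ ^ 2 := by
  have hs : ‖x‖ ≠ 0 := norm_ne_zero_iff.2 hx
  have h := sum_dir_sq hx
  have hc : Tendsto (fun y : E3 => ‖y‖) (𝓝 x) (𝓝 ‖x‖) := continuous_norm.tendsto x
  -- `√(det g) g⁻¹ ∇u` is the radial field `(w / s²) n`, because `g` fixes the radial direction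
  have hflux : ∀ i, (fun y => volDensity (rotParam r z) y * ∑ j, (metric (rotParam r z) y)⁻¹ i j *
      partialD (fun y => v ‖y‖) j y) =ᶠ[𝓝 x] fun y => w ‖y‖ / ‖y‖ ^ 2 * dir i y := by
    intro i
    filter_upwards [hc.eventually hr, hc.eventually hz, hc.eventually harc, hc.eventually hpos,
      hc.eventually hv, isOpen_ne.mem_nhds hx] with y h1 h2 h3 h4 h5 h6
    have hy : 0 < ‖y‖ := norm_pos_iff.2 h6
    have hφ : (r ‖y‖ / ‖y‖) ^ 2 ≠ 0 := by positivity
    have hn := sum_dir_sq h6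
    have hgrad : ∑ j, (metric (rotParam r z) y)⁻¹ i j * partialD (fun y => v ‖y‖) j y =
        w ‖y‖ / r ‖y‖ ^ 2 * dir i y := by
      rw [metric_rotParam h6 h1 h2 h3, axial_inv h6 one_ne_zero hφ]
      simp only [(hasPartialD_radial h6 h5 _).2, axial, Matrix.of_apply, Fin.sum_univ_three,
        Matrix.one_apply]
      generalize ((r ‖y‖ / ‖y‖) ^ 2)⁻¹ = φ
      generalize w ‖y‖ / r ‖y‖ ^ 2 = c
      fin_cases i <;> simp <;> grind
    rw [hgrad, volDensity_rotParam h6 h1 h2 h3]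
    field_simp
  have hq : HasDerivAt (fun s => w s / s ^ 2) (w' / ‖x‖ ^ 2 - 2 * w ‖x‖ / ‖x‖ ^ 3) ‖x‖ := by
    refine (hw.fun_div (hasDerivAt_pow 2 ‖x‖) (pow_ne_zero 2 hs)).congr_deriv ?_
    push_cast
    field_simp
  have hdiv : ∀ i, partialD (fun y : E3 => w ‖y‖ / ‖y‖ ^ 2 * dir i y) i x = _ := fun i =>
    ((hasPartialD_radial hx hq i).mul (hasPartialD_dir hx i i)).2
  have hterm : ∀ i, partialD (fun y => volDensity (rotParam r z) y *
      ∑ j, (metric (rotParam r z) y)⁻¹ i j * partialD (fun y => v ‖y‖) j y) i x = _ :=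
    fun i => (partialD_congr (hflux i) i).trans (hdiv i)
  have hr0 : r ‖x‖ ≠ 0 := hpos.self_of_nhds.ne'
  have hsum : laplaceBeltrami (rotParam r z) (fun y => v ‖y‖) x = _ :=
    congrArg (fun t => (volDensity (rotParam r z) x)⁻¹ * t)
      (Finset.sum_congr (rfl : (Finset.univ : Finset (Fin 3)) = _) fun i _ => hterm i)
  rw [hsum, volDensity_rotParam hx hr.self_of_nhds hz.self_of_nhds harc.self_of_nhds,
    inv_mul_eq_iff_eq_mul₀ (by positivity)]
  simp only [Fin.sum_univ_three, Matrix.one_apply_eq]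
  field_simp
  linear_combination (w' * ‖x‖ - 3 * w ‖x‖) * h

/-! ### Radius functions with integrable scalar curvature -/

/-- If `f' → L` at infinity, then `f s / s → L`. -/
lemma tendsto_div_of_tendsto_deriv {f f' : ℝ → ℝ} {L : ℝ} {a : ℝ}
    (hf : ∀ s, a < s → HasDerivAt f (f' s) s) (hlim : Tendsto f' atTop (𝓝 L)) :
    Tendsto (fun s => f s / s) atTop (𝓝 L) := by
  rw [Metric.tendsto_atTop]
  intro ε hε
  obtain ⟨S, hS⟩ := Metric.tendsto_atTop.1 hlim (ε / 2) (by positivity)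
  set T := max (max S (a + 1)) 1 with hT
  have hT1 : 1 ≤ T := le_max_right _ _
  have hTS : S ≤ T := (le_max_left _ _).trans (le_max_left _ _)
  have hTa : a < T := by
    have : a + 1 ≤ T := (le_max_right _ _).trans (le_max_left _ _)
    linarith
  have hbd : ∀ s, T ≤ s → |(f s - L * s) - (f T - L * T)| ≤ ε / 2 * (s - T) := by
    intro s hs
    have := Convex.norm_image_sub_le_of_norm_hasDerivWithin_le (f := fun t => f t - L * t)
      (f' := fun t => f' t - L) (C := ε / 2) (s := Ici T)
      (fun t ht => (((hf t (hTa.trans_le ht)).sub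
        (by simpa using (hasDerivAt_id' t).const_mul L)).hasDerivWithinAt))
      (fun t ht => by
        have := hS t (hTS.trans ht)
        rw [Real.dist_eq] at this
        exact this.le) (convex_Ici T) (self_mem_Ici) (show s ∈ Ici T from hs)
    rwa [Real.norm_eq_abs, Real.norm_eq_abs, abs_of_nonneg (sub_nonneg.2 hs)] at this
  refine ⟨max T (2 * |f T - L * T| / ε + 1), fun s hs => ?_⟩
  have hsT : T ≤ s := (le_max_left _ _).trans hs
  have hs2 : 2 * |f T - L * T| / ε + 1 ≤ s := (le_max_right _ _).trans hs
  have hs0 : 0 < s := by linarith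
  have h3 : 2 * |f T - L * T| / ε < s := by linarith
  rw [div_lt_iff₀ hε] at h3
  have e : f s / s - L = (f s - L * s) / s := by field_simp
  rw [Real.dist_eq, e, abs_div, abs_of_pos hs0, div_lt_iff₀ hs0]
  have h4 := abs_sub_abs_le_abs_sub (f s - L * s) (f T - L * T)
  have h5 := hbd s hsT
  nlinarith

lemma integrableOn_Ioi_const_div_sq (C : ℝ) {S : ℝ} (hS : 0 < S) :
    IntegrableOn (fun s : ℝ => C / s ^ 2) (Ioi S) := by
  have := (integrableOn_Ioi_rpow_of_lt (by norm_num : (-2 : ℝ) < -1) hS).const_mul C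
  refine IntegrableOn.congr_fun this (fun s hs => ?_) measurableSet_Ioi
  have hs0 : 0 < s := hS.trans hs
  rw [Real.rpow_neg hs0.le, div_eq_mul_inv]
  norm_num

/-- A `C²` radius function `ρ` (extended to the whole line) for the metric `ds² + ρ² dθ²` on `ℝ³`
of a hypersurface, whose scalar curvature is integrable: up to a constant factor the scalar
curvature is `(1 - ρ'² - 2 ρ ρ'') / ρ²`, and the volume element is `ρ² ds dθ`. -/
structure IsIntegrableRadius (ρ : ℝ → ℝ) : Prop where
  contDiff : ContDiff ℝ 2 ρ
  zero : ρ 0 = 0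
  deriv_zero : deriv ρ 0 = 1
  pos : ∀ s, 0 < s → 0 < ρ s
  sq_deriv_le : ∀ s, 0 < s → deriv ρ s ^ 2 ≤ 1
  integrableOn : IntegrableOn (fun s => 1 - deriv ρ s ^ 2 - 2 * ρ s * deriv (deriv ρ) s) (Ioi 0)

namespace IsIntegrableRadius

variable {ρ : ℝ → ℝ}

lemma hasDerivAt (h : IsIntegrableRadius ρ) (s : ℝ) : HasDerivAt ρ (deriv ρ s) s :=
  (h.contDiff.differentiable (by norm_num) s).hasDerivAt

lemma contDiff_deriv (h : IsIntegrableRadius ρ) : ContDiff ℝ 1 (deriv ρ) :=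
  ((contDiff_succ_iff_deriv (n := 1)).1 (by simpa [one_add_one_eq_two] using h.contDiff)).2.2

lemma hasDerivAt_deriv (h : IsIntegrableRadius ρ) (s : ℝ) : HasDerivAt (deriv ρ) (deriv (deriv ρ) s) s :=
  (h.contDiff_deriv.differentiable (by norm_num) s).hasDerivAt

lemma continuous (h : IsIntegrableRadius ρ) : Continuous ρ := h.contDiff.continuous

lemma continuous_deriv (h : IsIntegrableRadius ρ) : Continuous (deriv ρ) := h.contDiff_deriv.continuous

lemma continuous_deriv_deriv (h : IsIntegrableRadius ρ) : Continuous (deriv (deriv ρ)) :=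
  h.contDiff_deriv.continuous_deriv (by norm_num)

lemma abs_deriv_le (h : IsIntegrableRadius ρ) {s : ℝ} (hs : 0 < s) : |deriv ρ s| ≤ 1 :=
  abs_le_one_iff_mul_self_le_one.2 (by simpa [sq] using h.sq_deriv_le s hs)

/-- Two integrated forms of the curvature bound. The first one comes from
`(2 ρ ρ')' = 1 + ρ'² - G` with `G` the curvature density `1 - ρ'² - 2 ρ ρ''`; the second one from
`(ρ (1 - ρ'²))' = ρ' G`, where `ρ (1 - ρ'²)` is twice the Hawking mass of the sphere of
radius `s`. -/
lemma exists_bound (h : IsIntegrableRadius ρ) : ∃ C, 0 ≤ C ∧ ∀ s, 0 ≤ s →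
    s - C ≤ 2 * ρ s * deriv ρ s ∧ ρ s * (1 - deriv ρ s ^ 2) ≤ C := by
  set G : ℝ → ℝ := fun s => 1 - deriv ρ s ^ 2 - 2 * ρ s * deriv (deriv ρ) s with hG
  have hGc : Continuous fun s => |G s| := by
    have h1 := h.continuous
    have h2 := h.continuous_deriv
    have h3 := h.continuous_deriv_deriv
    fun_prop
  have hGi : IntegrableOn (fun s => |G s|) (Ioi 0) := h.integrableOn.abs
  set ψ : ℝ → ℝ := fun s => ∫ t in (0 : ℝ)..s, |G t| with hψ
  have hψd : ∀ s, HasDerivAt ψ |G s| s := fun s => hGc.integral_hasStrictDerivAt 0 s |>.hasDerivAt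
  have hψ0 : ψ 0 = 0 := by simp [hψ]
  have hψle : ∀ s, 0 ≤ s → ψ s ≤ ∫ t in Ioi (0 : ℝ), |G t| := by
    intro s hs
    simp only [hψ]
    rw [intervalIntegral.integral_of_le hs]
    exact setIntegral_mono_set hGi (Eventually.of_forall fun t => abs_nonneg _)
      (Eventually.of_forall fun t ht => ht.1)
  refine ⟨∫ t in Ioi (0 : ℝ), |G t|, integral_nonneg fun t => abs_nonneg _, fun s hs => ⟨?_, ?_⟩⟩
  · have hd : ∀ t, HasDerivAt (fun t => 2 * ρ t * deriv ρ t - t + ψ t)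
        (deriv ρ t ^ 2 + (|G t| - G t)) t := by
      intro t
      refine (((((h.hasDerivAt t).const_mul 2).mul (h.hasDerivAt_deriv t)).sub
        (hasDerivAt_id' t)).add (hψd t)).congr_deriv ?_
      simp only [hG]
      ring
    have hm : Monotone fun t => 2 * ρ t * deriv ρ t - t + ψ t :=
      monotone_of_hasDerivAt_nonneg hd fun t =>
        add_nonneg (sq_nonneg _) (sub_nonneg.2 (le_abs_self _))
    have := hm hs
    simp only [h.zero, hψ0] at this
    linarith [hψle s hs]
  · have hd : ∀ t, HasDerivAt (fun t => ψ t - ρ t * (1 - deriv ρ t ^ 2))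
        (|G t| - deriv ρ t * G t) t := by
      intro t
      refine ((hψd t).sub ((h.hasDerivAt t).mul
        ((hasDerivAt_const t (1 : ℝ)).sub ((h.hasDerivAt_deriv t).pow 2)))).congr_deriv ?_
      simp [hG]
      ring
    have hm : MonotoneOn (fun t => ψ t - ρ t * (1 - deriv ρ t ^ 2)) (Ici 0) := by
      refine monotoneOn_of_deriv_nonneg (convex_Ici 0)
        (fun t _ => (hd t).continuousAt.continuousWithinAt)
        (fun t _ => (hd t).differentiableAt.differentiableWithinAt) fun t ht => ?_
      rw [interior_Ici] at ht
      rw [(hd t).deriv, sub_nonneg]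
      calc deriv ρ t * G t ≤ |deriv ρ t| * |G t| := by rw [← abs_mul]; exact le_abs_self _
        _ ≤ 1 * |G t| := by gcongr; exact h.abs_deriv_le ht
        _ = |G t| := one_mul _
    have := hm self_mem_Ici (show s ∈ Ici 0 from hs) hs
    simp only [h.zero, hψ0] at this
    linarith [hψle s hs]

/-- Since `(ρ²)' = 2 ρ ρ' ≥ s - C`, the square `ρ²` is at least `s² / 2 - C s`. -/
lemma exists_linear_growth (h : IsIntegrableRadius ρ) : ∃ S, 1 ≤ S ∧ ∀ s, S ≤ s → s / 2 ≤ ρ s ∧ 0 < deriv ρ s := by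
  obtain ⟨C, hC, hb⟩ := h.exists_bound
  refine ⟨4 * C + 1, by linarith, fun s hs => ?_⟩
  have hs0 : 0 < s := by linarith
  have hρ := h.pos s hs0
  constructor
  · have hd : ∀ t, HasDerivAt (fun t => ρ t ^ 2 - (t ^ 2 / 2 - C * t))
        (2 * ρ t * deriv ρ t - (t - C)) t := by
      intro t
      refine (((h.hasDerivAt t).pow 2).sub ((((hasDerivAt_id' t).pow 2).div_const 2).sub
        ((hasDerivAt_id' t).const_mul C))).congr_deriv ?_
      simp
    have hm : MonotoneOn (fun t => ρ t ^ 2 - (t ^ 2 / 2 - C * t)) (Ici 0) := by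
      refine monotoneOn_of_deriv_nonneg (convex_Ici 0)
        (fun t _ => (hd t).continuousAt.continuousWithinAt)
        (fun t _ => (hd t).differentiableAt.differentiableWithinAt) fun t ht => ?_
      rw [interior_Ici] at ht
      rw [(hd t).deriv, sub_nonneg]
      exact (hb t (le_of_lt ht)).1
    have := hm self_mem_Ici (show s ∈ Ici 0 from hs0.le) hs0.le
    simp only [h.zero] at this
    nlinarith
  · have := (hb s hs0.le).1
    by_contra hneg
    have : ρ s * deriv ρ s ≤ 0 := mul_nonpos_of_nonneg_of_nonpos hρ.le (not_lt.1 hneg)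
    linarith

/-- With `ρ (1 - ρ'²)` bounded and `ρ → ∞`, `ρ'² → 1`; the sign is that of the eventually positive
`ρ'`. -/
lemma tendsto_deriv (h : IsIntegrableRadius ρ) : Tendsto (deriv ρ) atTop (𝓝 1) := by
  obtain ⟨C, hC, hb⟩ := h.exists_bound
  obtain ⟨S, hS, hg⟩ := h.exists_linear_growth
  have hlim : Tendsto (fun s : ℝ => 1 - 2 * C / s) atTop (𝓝 1) := by
    simpa using tendsto_const_nhds.sub (tendsto_const_nhds.div_atTop (tendsto_id (α := ℝ)))
  refine tendsto_of_tendsto_of_tendsto_of_le_of_le' hlim tendsto_const_nhds ?_ ?_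
  · filter_upwards [eventually_ge_atTop S] with s hs
    obtain ⟨h1, h2⟩ := hg s hs
    have hs0 : 0 < s := by linarith
    have h3 := (hb s hs0.le).2
    have h4 := (abs_le.1 (h.abs_deriv_le hs0)).2
    have h5 : s / 2 * (1 - deriv ρ s) ≤ C := by
      refine le_trans ?_ h3
      exact mul_le_mul h1 (by nlinarith) (by linarith) (h.pos s hs0).le
    rw [sub_le_comm, le_div_iff₀ hs0]
    linarith
  · filter_upwards [eventually_gt_atTop 0] with s hs
    exact (abs_le.1 (h.abs_deriv_le hs)).2

lemma tendsto_div (h : IsIntegrableRadius ρ) : Tendsto (fun s => ρ s / s) atTop (𝓝 1) :=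
  tendsto_div_of_tendsto_deriv (a := 0) (fun s _ => h.hasDerivAt s) h.tendsto_deriv

/-- `2 ρ ρ'' = (1 - ρ'²) - G` with `G` integrable and `1 - ρ'² = O(1 / s)`, and dividing by
`2 ρ ≥ s` leaves an integrable function. -/
lemma integrableOn_deriv_deriv (h : IsIntegrableRadius ρ) : IntegrableOn (deriv (deriv ρ)) (Ioi 0) := by
  obtain ⟨C, hC, hb⟩ := h.exists_bound
  obtain ⟨S, hS, hg⟩ := h.exists_linear_growth
  have hS0 : 0 < S := by linarith
  rw [← Ioc_union_Ioi_eq_Ioi hS0.le]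
  refine ((h.continuous_deriv_deriv.integrableOn_Icc).mono_set Ioc_subset_Icc_self).union ?_
  refine Integrable.mono' ((h.integrableOn.mono_set (Ioi_subset_Ioi hS0.le)).abs.add
    (integrableOn_Ioi_const_div_sq (2 * C) hS0))
    h.continuous_deriv_deriv.aestronglyMeasurable ?_
  refine (ae_restrict_iff' measurableSet_Ioi).2 (Eventually.of_forall fun s hs => ?_)
  obtain ⟨h1, -⟩ := hg s (le_of_lt hs)
  have hs1 : 1 ≤ s := hS.trans (le_of_lt hs)
  have hs0 : 0 < s := by linarith
  have h3 := (hb s hs0.le).2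
  have h4 : 0 ≤ 1 - deriv ρ s ^ 2 := sub_nonneg.2 (h.sq_deriv_le s hs0)
  have h5 : 1 - deriv ρ s ^ 2 ≤ 2 * C / s := by
    rw [le_div_iff₀ hs0]
    nlinarith
  set G := 1 - deriv ρ s ^ 2 - 2 * ρ s * deriv (deriv ρ) s with hG
  have h6 : s * |deriv (deriv ρ) s| ≤ |G| + 2 * C / s := by
    calc s * |deriv (deriv ρ) s| ≤ 2 * ρ s * |deriv (deriv ρ) s| := by gcongr; linarith
      _ = |(1 - deriv ρ s ^ 2) - G| := by
        rw [hG, sub_sub_cancel, abs_mul, abs_of_pos (by linarith : 0 < 2 * ρ s)]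
      _ ≤ |1 - deriv ρ s ^ 2| + |G| := abs_sub _ _
      _ ≤ |G| + 2 * C / s := by rw [abs_of_nonneg h4]; linarith
  simp only [Pi.add_apply, Real.norm_eq_abs]
  have h7 : |deriv (deriv ρ) s| ≤ |G| / s + 2 * C / s ^ 2 := by
    have : |G| / s + 2 * C / s ^ 2 = (|G| + 2 * C / s) / s := by field_simp
    rw [this, le_div_iff₀ hs0]
    linarith
  exact h7.trans (by gcongr; exact div_le_self (abs_nonneg _) hs1)

lemma integral_deriv_deriv (h : IsIntegrableRadius ρ) : ∫ s in Ioi (0 : ℝ), deriv (deriv ρ) s = 0 := by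
  rw [integral_Ioi_of_hasDerivAt_of_tendsto' (fun s _ => h.hasDerivAt_deriv s)
    h.integrableOn_deriv_deriv h.tendsto_deriv, h.deriv_zero, sub_self]

/-- Unless the metric is flat, `ρ` is strictly concave somewhere: if `ρ'' ≥ 0` then `ρ'` increases
from its maximal value `1`. -/
lemma exists_deriv_deriv_neg (h : IsIntegrableRadius ρ) (hflat : ∃ s, 0 < s ∧ deriv ρ s ≠ 1) :
    ∃ s, 0 < s ∧ deriv (deriv ρ) s < 0 := by
  by_contra! hc
  obtain ⟨s, hs, hne⟩ := hflat
  have hm : MonotoneOn (deriv ρ) (Ici 0) := by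
    refine monotoneOn_of_deriv_nonneg (convex_Ici 0) h.continuous_deriv.continuousOn
      (fun t _ => (h.hasDerivAt_deriv t).differentiableAt.differentiableWithinAt) fun t ht => ?_
    rw [interior_Ici] at ht
    exact hc t ht
  have h1 := hm self_mem_Ici (show s ∈ Ici 0 from hs.le) hs.le
  rw [h.deriv_zero] at h1
  exact hne (le_antisymm (abs_le.1 (h.abs_deriv_le hs)).2 h1)

/-- A radial profile of a superharmonic function: `ρ² v' = -H` for the nondecreasing cutoff `H`
that vanishes on `(-∞, 1]`. Since `ρ⁻²` is integrable at infinity, `v` can be kept positive. -/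
lemma exists_superharmonic_profile (h : IsIntegrableRadius ρ) : ∃ v : ℝ → ℝ, ContDiff ℝ 2 v ∧ (∀ s, 0 ≤ s → 0 < v s) ∧
    (∀ s, 0 < s → HasDerivAt v (-smoothTransition (s - 1) / ρ s ^ 2) s) ∧
    ∀ s, s ≤ 1 → v s = v 0 := by
  set f : ℝ → ℝ := fun s => smoothTransition (s - 1) / ρ s ^ 2 with hf
  have hf0 : ∀ s, s ≤ 1 → f s = 0 := fun s hs => by
    simp [hf, smoothTransition.zero_of_nonpos (sub_nonpos.2 hs)]
  have hfn : ∀ s, 0 ≤ f s := fun s => div_nonneg (smoothTransition.nonneg _) (sq_nonneg _)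
  have hf1 : ContDiff ℝ 1 f := by
    rw [contDiff_iff_contDiffAt]
    intro s
    rcases lt_or_ge 0 s with hs | hs
    · exact (smoothTransition.contDiffAt.comp s (contDiffAt_id.sub contDiffAt_const)).div
        ((h.contDiff.of_le (by norm_num)).contDiffAt.pow 2) (pow_ne_zero 2 (h.pos s hs).ne')
    · refine (contDiffAt_const (c := (0 : ℝ))).congr_of_eventuallyEq ?_
      filter_upwards [Iio_mem_nhds (hs.trans_lt one_pos)] with t ht
      exact hf0 t (le_of_lt ht)
  have hfi : IntegrableOn f (Ioi 0) := by
    obtain ⟨S, hS, hg⟩ := h.exists_linear_growth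
    have hS0 : 0 < S := by linarith
    rw [← Ioc_union_Ioi_eq_Ioi hS0.le]
    refine ((hf1.continuous.integrableOn_Icc).mono_set Ioc_subset_Icc_self).union ?_
    refine Integrable.mono' (integrableOn_Ioi_const_div_sq 4 hS0)
      hf1.continuous.aestronglyMeasurable ?_
    refine (ae_restrict_iff' measurableSet_Ioi).2 (Eventually.of_forall fun s hs => ?_)
    obtain ⟨h1, -⟩ := hg s (le_of_lt hs)
    have hs0 : 0 < s := hS0.trans hs
    rw [Real.norm_eq_abs, abs_of_nonneg (hfn s)]
    calc f s ≤ 1 / (s / 2) ^ 2 := by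
          simp only [hf]
          gcongr
          exact smoothTransition.le_one _
      _ = 4 / s ^ 2 := by field_simp; norm_num
  have hFd : ∀ s, HasDerivAt (fun s => ∫ t in (0 : ℝ)..s, f t) (f s) s := fun s =>
    (hf1.continuous.integral_hasStrictDerivAt 0 s).hasDerivAt
  set v : ℝ → ℝ := fun s => (1 + ∫ t in Ioi (0 : ℝ), f t) - ∫ t in (0 : ℝ)..s, f t with hv
  have hvd : ∀ s, HasDerivAt v (-f s) s := fun s => (hFd s).const_sub _
  refine ⟨v, ?_, fun s hs => ?_, fun s _ => ?_, fun s hs => ?_⟩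
  · have h2 : ContDiff ℝ (1 + 1) v := by
      refine contDiff_succ_iff_deriv.2 ⟨fun s => (hvd s).differentiableAt, by simp, ?_⟩
      rw [funext fun s => (hvd s).deriv]
      exact hf1.neg
    rwa [one_add_one_eq_two] at h2
  · have : ∫ t in (0 : ℝ)..s, f t ≤ ∫ t in Ioi (0 : ℝ), f t := by
      rw [intervalIntegral.integral_of_le hs]
      exact setIntegral_mono_set hfi (Eventually.of_forall hfn)
        (Eventually.of_forall fun t ht => ht.1)
    simp only [hv]
    linarith
  · rw [neg_div]
    exact hvd s
  · have : ∫ t in (0 : ℝ)..s, f t = 0 := by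
      rw [intervalIntegral.integral_congr (g := fun _ => 0)]
      · simp
      · intro t ht
        refine hf0 t ?_
        rw [mem_uIcc] at ht
        rcases ht with ht | ht <;> linarith [ht.2]
    simp [hv, this]

end IsIntegrableRadius

/-! ### The constant `η₂` -/

lemma eta_two {a : ℝ} (ha : 0 < a) : eta a 2 = a := by
  set k := π / (2 * a) with hk
  have hk0 : k ≠ 0 := by positivity
  have hka : k * a = π / 2 := by rw [hk]; field_simp
  have hd : ∀ u, deriv (chi1 a) u = -k * Real.sin (k * u) := by
    intro u
    have : HasDerivAt (chi1 a) (-Real.sin (k * u) * (k * 1)) u :=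
      (((hasDerivAt_id' u).const_mul k).cos)
    rw [this.deriv]
    ring
  -- an antiderivative of the integrand `-k² u² cos (2 k u)`
  have hF : ∀ u, HasDerivAt (fun u => -(k / 2) * (u ^ 2 * Real.sin (2 * k * u))
      - 1 / 2 * (u * Real.cos (2 * k * u)) + 1 / (4 * k) * Real.sin (2 * k * u))
      (u ^ 2 * (deriv (chi1 a) u ^ 2 - k ^ 2 * chi1 a u ^ 2)) u := by
    intro u
    have hl : HasDerivAt (fun u => 2 * k * u) (2 * k) u := by
      simpa using (hasDerivAt_id' u).const_mul (2 * k)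
    refine ((((((hasDerivAt_id' u).pow 2).mul hl.sin).const_mul _).sub
      (((hasDerivAt_id' u).mul hl.cos).const_mul _)).add (hl.sin.const_mul _)).congr_deriv ?_
    have hc : Real.cos (2 * k * u) = Real.cos (k * u) ^ 2 - Real.sin (k * u) ^ 2 := by
      rw [mul_assoc, Real.cos_two_mul']
    rw [hd, chi1, ← hk, hc]
    simp
    field_simp
    ring
  have hcont : Continuous fun u => u ^ 2 * (deriv (chi1 a) u ^ 2 - k ^ 2 * chi1 a u ^ 2) := by
    rw [funext hd]
    unfold chi1
    fun_prop
  rw [eta, intervalIntegral.integral_eq_sub_of_hasDerivAt (fun u _ => hF u)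
    (hcont.intervalIntegrable _ _)]
  have h1 : 2 * k * a = π := by rw [mul_assoc, hka]; ring
  have h2 : 2 * k * -a = -π := by rw [mul_neg, h1]
  rw [h1, h2, Real.cos_neg, Real.sin_neg, Real.sin_pi, Real.cos_pi]
  ring

/-! ### The radius function of a spherically symmetric hypersurface -/

lemma _root_.ContDiffOn.differentiableAt_deriv_Ioi {f : ℝ → ℝ} (hf : ContDiffOn ℝ 2 f (Ioi 0))
    {s : ℝ} (hs : 0 < s) : DifferentiableAt ℝ (deriv f) s := by
  have h : ContDiffOn ℝ (1 + 1) f (Ioi 0) := by rwa [one_add_one_eq_two]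
  exact (((contDiffOn_succ_iff_deriv_of_isOpen isOpen_Ioi).1 h).2.2.differentiableOn
    (by norm_num)).differentiableAt (Ioi_mem_nhds hs)

lemma _root_.ContDiffOn.eventually_differentiableAt_Ioi {f : ℝ → ℝ}
    (hf : ContDiffOn ℝ 2 f (Ioi 0)) {s : ℝ} (hs : 0 < s) :
    ∀ᶠ t in 𝓝 s, DifferentiableAt ℝ f t := by
  filter_upwards [Ioi_mem_nhds hs] with t ht
  exact (hf.differentiableOn (by norm_num)).differentiableAt (Ioi_mem_nhds ht)

/-- The `k`-th coordinate of `p` along the first coordinate axis of the parameter space. For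
`k = 0` it is the odd extension of `r` to the line, for `k = 3` the even extension of `z`. -/
def axisProfile (r z : ℝ → ℝ) (k : Fin 4) (t : ℝ) : ℝ :=
  rotParam r z (EuclideanSpace.single 0 t) k

namespace IsSphSymWithPole

variable {r z : ℝ → ℝ}

lemma contDiff_axisProfile (hS : IsSphSymWithPole r z) (k : Fin 4) :
    ContDiff ℝ 2 (axisProfile r z k) := by
  have h1 : ContDiff ℝ 2 fun t : ℝ => (EuclideanSpace.single 0 t : E3) := by
    refine contDiff_euclidean.2 fun i => ?_
    by_cases hi : i = 0
    · subst hi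
      simp only [PiLp.single_apply, if_true]
      exact contDiff_id
    · simpa [hi] using contDiff_const
  exact contDiff_euclidean.1 (hS.contDiff_param.comp h1) k

lemma axisProfile_zero_eq (hS : IsSphSymWithPole r z) {s : ℝ} (hs : 0 ≤ s) :
    axisProfile r z 0 s = r s := by
  rcases hs.eq_or_lt with rfl | hs
  · simp [axisProfile, rotParam, hS.r_zero]
  · simp [axisProfile, rotParam, abs_of_pos hs, hs.ne']

lemma _root_.RotHyp.axisProfile_three_eq {s : ℝ} (hs : 0 ≤ s) : axisProfile r z 3 s = z s := by
  simp [axisProfile, rotParam, abs_of_nonneg hs]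

lemma deriv_axisProfile_zero_eq (hS : IsSphSymWithPole r z) {s : ℝ} (hs : 0 < s) :
    deriv (axisProfile r z 0) s = deriv r s := by
  refine EventuallyEq.deriv_eq ?_
  filter_upwards [Ioi_mem_nhds hs] with t ht
  exact hS.axisProfile_zero_eq (le_of_lt ht)

lemma deriv_deriv_axisProfile_zero_eq (hS : IsSphSymWithPole r z) {s : ℝ} (hs : 0 < s) :
    deriv (deriv (axisProfile r z 0)) s = deriv (deriv r) s := by
  refine EventuallyEq.deriv_eq ?_
  filter_upwards [Ioi_mem_nhds hs] with t ht
  exact hS.deriv_axisProfile_zero_eq ht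

lemma deriv_axisProfile_zero_zero (hS : IsSphSymWithPole r z) :
    deriv (axisProfile r z 0) 0 = 1 := by
  have h1 : HasDerivWithinAt (axisProfile r z 0) 1 (Ici 0) 0 :=
    hS.deriv_r_zero.congr (fun t ht => hS.axisProfile_zero_eq ht)
      (hS.axisProfile_zero_eq le_rfl)
  have h2 : HasDerivWithinAt (axisProfile r z 0) (deriv (axisProfile r z 0) 0) (Ici 0) 0 :=
    ((hS.contDiff_axisProfile 0).differentiable (by norm_num) 0).hasDerivAt.hasDerivWithinAt
  exact (uniqueDiffWithinAt_Ici 0).eq_deriv _ h2 h1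

/-- Differentiating `r'² + z'² = 1` gives `k_s z' = -r''`. -/
lemma kS_mul_kTheta_mul (hS : IsSphSymWithPole r z) {s : ℝ} (hs : 0 < s) :
    kS r z s * kTheta r z s * r s = - deriv (deriv r) s := by
  have hr0 := (hS.r_pos s hs).ne'
  have h1 := (hS.contDiffOn_r.differentiableAt_deriv_Ioi hs).hasDerivAt
  have h2 := (hS.contDiffOn_z.differentiableAt_deriv_Ioi hs).hasDerivAt
  have h3 := (h1.pow 2).add (h2.pow 2)
  have h4 : HasDerivAt (deriv r ^ 2 + deriv z ^ 2) 0 s := by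
    refine (hasDerivAt_const s (1 : ℝ)).congr_of_eventuallyEq ?_
    filter_upwards [Ioi_mem_nhds hs] with t ht
    exact hS.arcLength t ht
  have h5 := h3.unique h4
  have h6 := hS.arcLength s hs
  norm_num at h5
  rw [kS, kTheta, mul_assoc, div_mul_cancel₀ _ hr0]
  linear_combination deriv r s / 2 * h5 - deriv (deriv r) s * h6

lemma c2_eq (hS : IsSphSymWithPole r z) {x : E3} (hx : x ≠ 0) :
    c2 (rotParam r z) x =
      (1 - deriv r ‖x‖ ^ 2 - 2 * r ‖x‖ * deriv (deriv r) ‖x‖) / r ‖x‖ ^ 2 := by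
  have hs : 0 < ‖x‖ := norm_pos_iff.2 hx
  have hr0 := (hS.r_pos _ hs).ne'
  have hk := hS.kS_mul_kTheta_mul hs
  have harc := hS.arcLength _ hs
  rw [c2_rotParam hx (hS.contDiffOn_r.eventually_differentiableAt_Ioi hs)
    (hS.contDiffOn_z.eventually_differentiableAt_Ioi hs)
    (hS.contDiffOn_r.differentiableAt_deriv_Ioi hs)
    (hS.contDiffOn_z.differentiableAt_deriv_Ioi hs) harc (hS.r_pos _ hs),
    eq_div_iff (pow_ne_zero 2 hr0)]
  have h2 : kTheta r z ‖x‖ * r ‖x‖ = deriv z ‖x‖ := div_mul_cancel₀ _ hr0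
  linear_combination 2 * r ‖x‖ * hk
    + (kTheta r z ‖x‖ * r ‖x‖ + deriv z ‖x‖) * h2 + harc

/-- In geodesic polar coordinates the integral of `𝒦₂` over the hypersurface is
`4 π η₂ ∫ (1 - r'² - 2 r r'') ds`. -/
lemma isIntegrableRadius (hS : IsSphSymWithPole r z) {a : ℝ} (ha : 0 < a)
    (hK : Integrable (calK2 a (rotParam r z)) (volMeasure (rotParam r z))) :
    IsIntegrableRadius (axisProfile r z 0) where
  contDiff := hS.contDiff_axisProfile 0
  zero := (hS.axisProfile_zero_eq le_rfl).trans hS.r_zero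
  deriv_zero := hS.deriv_axisProfile_zero_zero
  pos s hs := by
    rw [hS.axisProfile_zero_eq hs.le]
    exact hS.r_pos s hs
  sq_deriv_le s hs := by
    rw [hS.deriv_axisProfile_zero_eq hs]
    nlinarith [hS.arcLength s hs, sq_nonneg (deriv z s)]
  integrableOn := by
    set ρ := axisProfile r z 0 with hρ
    have hne : ∀ᵐ x : E3, x ≠ 0 := by
      simp [ae_iff]
    have hvol : ∀ᵐ x : E3, ENNReal.ofReal (volDensity (rotParam r z) x) =
        ENNReal.ofReal ((ρ ‖x‖ / ‖x‖) ^ 2) := by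
      filter_upwards [hne] with x hx
      have hs : 0 < ‖x‖ := norm_pos_iff.2 hx
      rw [volDensity_rotParam hx
        (hS.contDiffOn_r.eventually_differentiableAt_Ioi hs).self_of_nhds
        (hS.contDiffOn_z.eventually_differentiableAt_Ioi hs).self_of_nhds (hS.arcLength _ hs),
        hρ, hS.axisProfile_zero_eq hs.le]
    have hmeas : Measurable fun x : E3 => ENNReal.ofReal ((ρ ‖x‖ / ‖x‖) ^ 2) := by
      have := (hS.contDiff_axisProfile 0).continuous.measurable
      rw [← hρ] at this
      fun_prop
    rw [volMeasure, withDensity_congr_ae hvol, integrable_withDensity_iff_integrable_smul' hmeas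
      (Eventually.of_forall fun _ => ENNReal.ofReal_lt_top)] at hK
    set F : ℝ → ℝ := fun s => (ρ s / s) ^ 2 * (a *
      ((1 - deriv ρ s ^ 2 - 2 * ρ s * deriv (deriv ρ) s) / ρ s ^ 2)) with hF
    have hK2 : Integrable fun x : E3 => F ‖x‖ := by
      refine hK.congr ?_
      filter_upwards [hne] with x hx
      have hs : 0 < ‖x‖ := norm_pos_iff.2 hx
      rw [ENNReal.toReal_ofReal (by positivity), smul_eq_mul, calK2, eta_two ha, hS.c2_eq hx]
      simp only [hF, hρ, hS.axisProfile_zero_eq hs.le, hS.deriv_axisProfile_zero_eq hs,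
        hS.deriv_deriv_axisProfile_zero_eq hs]
    have hK3 := (integrable_fun_norm_addHaar (volume : Measure E3) (f := F)).1 hK2
    refine IntegrableOn.congr_fun (hK3.const_mul a⁻¹) (fun s hs => ?_) measurableSet_Ioi
    have hs0 : s ≠ 0 := (show 0 < s from hs).ne'
    have hρ0 : ρ s ≠ 0 := by
      rw [hρ, hS.axisProfile_zero_eq (le_of_lt hs)]
      exact (hS.r_pos s hs).ne'
    simp only [hF, finrank_euclideanSpace, Fintype.card_fin, smul_eq_mul]
    norm_num
    field_simp

/-- If `r' = 1` then `r(s) = s` and `z` is constant. -/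
lemma isHyperplane (hS : IsSphSymWithPole r z)
    (h1 : ∀ s, 0 < s → deriv (axisProfile r z 0) s = 1) :
    IsHyperplane (range (rotParam r z)) := by
  have hslope : ∀ (k : Fin 4) (s : ℝ), 0 < s → ∃ c, 0 < c ∧
      deriv (axisProfile r z k) c * s = axisProfile r z k s - axisProfile r z k 0 := by
    intro k s hs
    have hd := hS.contDiff_axisProfile k
    obtain ⟨c, hc, he⟩ := exists_deriv_eq_slope (axisProfile r z k) hs hd.continuous.continuousOn
      (hd.differentiable (by norm_num)).differentiableOn
    refine ⟨c, hc.1, ?_⟩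
    rw [he, sub_zero, div_mul_cancel₀ _ hs.ne']
  have hr : ∀ s, 0 ≤ s → r s = s := by
    intro s hs
    rcases hs.eq_or_lt with rfl | hs
    · exact hS.r_zero
    · obtain ⟨c, hc, he⟩ := hslope 0 s hs
      rw [h1 c hc, hS.axisProfile_zero_eq hs.le, hS.axisProfile_zero_eq le_rfl, hS.r_zero] at he
      linarith
  have hz : ∀ s, 0 ≤ s → z s = z 0 := by
    intro s hs
    rcases hs.eq_or_lt with rfl | hs
    · rfl
    · obtain ⟨c, hc, he⟩ := hslope 3 s hs
      have hzc : deriv (axisProfile r z 3) c = deriv z c := by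
        refine EventuallyEq.deriv_eq ?_
        filter_upwards [Ioi_mem_nhds hc] with t ht
        exact axisProfile_three_eq (le_of_lt ht)
      have h2 := hS.arcLength c hc
      rw [← hS.deriv_axisProfile_zero_eq hc, h1 c hc] at h2
      have h3 : deriv z c = 0 := by
        have : deriv z c ^ 2 = 0 := by linarith
        exact pow_eq_zero_iff (two_ne_zero) |>.1 this
      rw [hzc, h3, axisProfile_three_eq hs.le, axisProfile_three_eq le_rfl] at he
      linarith
  have hcoord : ∀ (x : E3) (k : Fin 3), r ‖x‖ * (x k / ‖x‖) = x k := by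
    intro x k
    rw [hr _ (norm_nonneg x)]
    rcases eq_or_ne x 0 with rfl | hx
    · simp
    · rw [mul_div_cancel₀]
      exact norm_ne_zero_iff.2 hx
  set e : E4 := EuclideanSpace.single 3 1 with he
  have he0 : e ≠ 0 := by simp [he]
  refine ⟨AffineSubspace.mk' (z 0 • e) (ℝ ∙ e)ᗮ, ?_, ?_⟩
  · rw [AffineSubspace.direction_mk']
    have : Fact (Module.finrank ℝ E4 = 3 + 1) := ⟨by simp⟩
    exact Submodule.finrank_orthogonal_span_singleton he0
  · have hmem : ∀ y : E4, y ∈ AffineSubspace.mk' (z 0 • e) (ℝ ∙ e)ᗮ ↔ y 3 = z 0 := by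
      intro y
      rw [AffineSubspace.mem_mk', Submodule.mem_orthogonal_singleton_iff_inner_right]
      simp [he, EuclideanSpace.inner_single_left, sub_eq_zero]
    ext y
    rw [SetLike.mem_coe, hmem]
    constructor
    · rintro ⟨x, rfl⟩
      exact hz _ (norm_nonneg x)
    · intro hy
      refine ⟨!₂[y 0, y 1, y 2], ?_⟩
      ext k
      set x : E3 := !₂[y 0, y 1, y 2] with hx
      fin_cases k
      · exact hcoord x 0
      · exact hcoord x 1
      · exact hcoord x 2
      · exact (hz _ (norm_nonneg x)).trans hy.symm

/-! ### Non-parabolicity and the domain of positive curvature -/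

/-- A `C²` radial function that is constant near the pole and has nonincreasing flux is
superharmonic. -/
lemma isNonParabolic (hS : IsSphSymWithPole r z) (h : IsIntegrableRadius (axisProfile r z 0)) :
    IsNonParabolic (rotParam r z) := by
  obtain ⟨v, hv, hpos, hd, hconst⟩ := h.exists_superharmonic_profile
  set e := hS.isEmbedding_param.toHomeomorph with he
  have hcomp : (fun q => v ‖e.symm q‖) ∘ rangeFactorization (rotParam r z) = fun x => v ‖x‖ := by
    funext x
    have : e.symm (rangeFactorization (rotParam r z) x) = x := e.symm_apply_apply x
    simp [this]
  have hnear : (fun x : E3 => v ‖x‖) =ᶠ[𝓝 0] fun _ => v 0 := by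
    filter_upwards [Metric.ball_mem_nhds (0 : E3) one_pos] with x hx
    exact hconst _ (le_of_lt (by simpa using hx))
  refine ⟨fun q => v ‖e.symm q‖, ⟨?_, fun x => ?_⟩, fun q => hpos _ (norm_nonneg _), ?_⟩
  · rw [hcomp, contDiff_iff_contDiffAt]
    intro x
    rcases eq_or_ne x 0 with rfl | hx
    · exact contDiffAt_const.congr_of_eventuallyEq hnear
    · exact hv.contDiffAt.comp x (contDiffAt_norm ℝ hx)
  · rw [hcomp]
    rcases eq_or_ne x 0 with rfl | hx
    · have hz : ∀ i, partialD (fun y => volDensity (rotParam r z) y *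
          ∑ j, (metric (rotParam r z) y)⁻¹ i j * partialD (fun x : E3 => v ‖x‖) j y) i 0 = 0 := by
        intro i
        rw [partialD_congr (g := fun _ => (0 : ℝ)) ?_ i, (hasPartialD_const 0 i 0).2]
        filter_upwards [hnear.eventuallyEq_nhds] with y hy
        simp [partialD_congr hy, (hasPartialD_const (v 0) _ y).2]
      refine le_of_eq ?_
      exact (congrArg (fun t => (volDensity (rotParam r z) 0)⁻¹ * t)
        (Finset.sum_eq_zero fun i _ => hz i)).trans (mul_zero _)
    · have hs : 0 < ‖x‖ := norm_pos_iff.2 hx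
      have hw : HasDerivAt (fun s => -smoothTransition (s - 1))
          (-deriv smoothTransition (‖x‖ - 1)) ‖x‖ :=
        (((smoothTransition.contDiff (n := 1)).differentiable (by norm_num)
          (‖x‖ - 1)).hasDerivAt.comp_sub_const ‖x‖ 1).neg
      rw [laplaceBeltrami_radial hx (hS.contDiffOn_r.eventually_differentiableAt_Ioi hs)
        (hS.contDiffOn_z.eventually_differentiableAt_Ioi hs)
        (eventually_of_mem (Ioi_mem_nhds hs) hS.arcLength)
        (eventually_of_mem (Ioi_mem_nhds hs) hS.r_pos)
        (eventually_of_mem (Ioi_mem_nhds hs) fun s hs => by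
          have := hd s hs
          rwa [hS.axisProfile_zero_eq (le_of_lt hs)] at this) hw]
      exact div_nonpos_of_nonpos_of_nonneg (neg_nonpos.2 smoothTransition.monotone.deriv_nonneg)
        (sq_nonneg _)
  · by_contra! hall
    have hv2 : ∀ s, 0 ≤ s → v s = v 0 := by
      intro s hs
      have := hall (e (EuclideanSpace.single 0 s)) (e 0)
      simpa [abs_of_nonneg hs] using this
    have h1 : HasDerivAt v 0 2 := by
      refine (hasDerivAt_const 2 (v 0)).congr_of_eventuallyEq ?_
      filter_upwards [Ioi_mem_nhds (zero_lt_two' ℝ)] with t ht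
      exact hv2 t (le_of_lt ht)
    have h2 := h1.unique (hd 2 two_pos)
    have h3 := h.pos 2 two_pos
    rw [smoothTransition.one_of_one_le (by norm_num)] at h2
    have : 0 < 1 / axisProfile r z 0 2 ^ 2 := by positivity
    rw [neg_div] at h2
    linarith

/-- By `k_s k_θ r = -r''` the curvatures have the same sign where `r'' < 0`, which holds on a small
ball of the parameter space. At the origin `k_θ` has the junk value `z' / 0 = 0`, so the ball avoids
it. -/
lemma exists_domain (hS : IsSphSymWithPole r z) (h : IsIntegrableRadius (axisProfile r z 0))
    (hplane : ¬ IsHyperplane (range (rotParam r z))) :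
    ∃ U : Set (range (rotParam r z)), IsOpen U ∧ IsConnected U ∧
      ∀ x : E3, rangeFactorization (rotParam r z) x ∈ U →
        0 < kS r z ‖x‖ * kTheta r z ‖x‖ := by
  have hflat : ∃ s, 0 < s ∧ deriv (axisProfile r z 0) s ≠ 1 := by
    by_contra! hc
    exact hplane (hS.isHyperplane hc)
  obtain ⟨s, hs, hneg⟩ := h.exists_deriv_deriv_neg hflat
  have hopen : IsOpen {x : E3 | 0 < ‖x‖ ∧ deriv (deriv (axisProfile r z 0)) ‖x‖ < 0} :=
    (isOpen_lt continuous_const continuous_norm).inter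
      (isOpen_lt (h.continuous_deriv_deriv.comp continuous_norm) continuous_const)
  obtain ⟨δ, hδ, hball⟩ := Metric.isOpen_iff.1 hopen (EuclideanSpace.single 0 s)
    (by simpa [abs_of_pos hs, hs.ne'] using hneg)
  set e := hS.isEmbedding_param.toHomeomorph with he
  refine ⟨e '' Metric.ball (EuclideanSpace.single 0 s) δ, e.isOpenMap _ Metric.isOpen_ball,
    ⟨(Metric.nonempty_ball.2 hδ).image _, ((convex_ball _ δ).isPreconnected).image _
      e.continuous.continuousOn⟩, ?_⟩
  rintro x ⟨y, hy, hyx⟩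
  obtain rfl : y = x := e.injective hyx
  obtain ⟨h1, h2⟩ := hball hy
  rw [hS.deriv_deriv_axisProfile_zero_eq h1] at h2
  have h3 := hS.kS_mul_kTheta_mul h1
  exact pos_of_mul_pos_left (by rw [h3]; linarith) (hS.r_pos _ h1).le

end IsSphSymWithPole

end RotHyp

end

theorem lemma2 (a : ℝ) (ha : 0 < a) (r z : ℝ → ℝ)
    (hS : RotHyp.IsSphSymWithPole r z)
    (hplane : ¬ RotHyp.IsHyperplane (Set.range (RotHyp.rotParam r z)))
    (hK : MeasureTheory.Integrable (RotHyp.calK2 a (RotHyp.rotParam r z))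
      (RotHyp.volMeasure (RotHyp.rotParam r z))) :
    RotHyp.IsNonParabolic (RotHyp.rotParam r z) ∧
    Filter.Tendsto (fun s : ℝ => r s / s) Filter.atTop (nhds 1) ∧
    (MeasureTheory.IntegrableOn
        (fun s => RotHyp.kS r z s * RotHyp.kTheta r z s * r s) (Set.Ioi 0) ∧
      ∫ s in Set.Ioi (0 : ℝ), RotHyp.kS r z s * RotHyp.kTheta r z s * r s = 0) ∧
    ∃ U : Set (Set.range (RotHyp.rotParam r z)), IsOpen U ∧ IsConnected U ∧
      ∀ x : RotHyp.E3, Set.rangeFactorization (RotHyp.rotParam r z) x ∈ U →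
        0 < RotHyp.kS r z ‖x‖ * RotHyp.kTheta r z ‖x‖ := by
  have h := hS.isIntegrableRadius ha hK
  have hk : EqOn (fun s => -deriv (deriv (RotHyp.axisProfile r z 0)) s)
      (fun s => RotHyp.kS r z s * RotHyp.kTheta r z s * r s) (Ioi 0) := fun s hs => by
    simp only [hS.kS_mul_kTheta_mul hs, hS.deriv_deriv_axisProfile_zero_eq hs]
  refine ⟨hS.isNonParabolic h, h.tendsto_div.congr' ?_,
    ⟨IntegrableOn.congr_fun h.integrableOn_deriv_deriv.neg hk measurableSet_Ioi, ?_⟩,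
    hS.exists_domain h hplane⟩
  · filter_upwards [eventually_ge_atTop 0] with s hs
    rw [hS.axisProfile_zero_eq hs]
  · rw [← setIntegral_congr_fun measurableSet_Ioi hk, integral_neg, h.integral_deriv_deriv,
      neg_zero]
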